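/- Let $H$ be a compact Polish abelian group equipped with its Haar measure $\mu$, and let $\mathcal{H}_\mu(H)$ be the space of all homeomorphisms $f:H\to H$ that preserve $\mu$, with the compact-open topology. Let $G\subseteq \mathcal{H}_\mu(H)$ be an uncountable $G_\delta$ set and let $B\subseteq H$ be co-null, i.e. $\mu(H\setminus B)=0$. Here a perfect set is a nonempty closed set without isolated points. Then: 1. for every $\sigma$-finite Borel measure $\nu$ on $G$ there are a perfect set $P\subseteq H$ and an $F_\sigma$ subset $W$ of $\mathcal{H}_\mu(H)$ with $W\subseteq G$ and $\nu(G\setminus W)=0$ such that $P\subseteq f[B]$ for every $f\in W$; 2. there are a perfect subset $Q$ of $\mathcal{H}_\mu(H)$ with $Q\subseteq G$ and an $F_\sigma$ set $W\subseteq H$ with $\mu(H\setminus W)=0$ such that $W\subseteq f[B]$ for every $f\in Q$. -/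

import Mathlib

open MeasureTheory

universe u

/-- The set of all homeomorphisms of the space `X` onto itself that preserve the measure `μ`. -/
def MPHomeo {X : Type u} [TopologicalSpace X] [MeasurableSpace X] (μ : Measure X) : Type u :=
  {f : X ≃ₜ X // MeasurePreserving f μ μ}

namespace MPHomeo

/-- The underlying homeomorphism. -/
def toHomeo {X : Type u} [TopologicalSpace X] [MeasurableSpace X] {μ : Measure X}
    (f : MPHomeo μ) : X ≃ₜ X :=
  f.1

/-- The underlying continuous map. -/
def toContinuousMap {X : Type u} [TopologicalSpace X] [MeasurableSpace X] {μ : Measure X}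
    (f : MPHomeo μ) : C(X, X) :=
  ⟨f.toHomeo, f.toHomeo.continuous⟩

/-- The compact-open topology: the subspace topology from `C(X, X)`, which in Mathlib carries the
compact-open topology. -/
instance {X : Type u} [TopologicalSpace X] [MeasurableSpace X] {μ : Measure X} :
    TopologicalSpace (MPHomeo μ) :=
  TopologicalSpace.induced toContinuousMap inferInstance

/-- The Borel σ-algebra of the compact-open topology. -/
instance {X : Type u} [TopologicalSpace X] [MeasurableSpace X] {μ : Measure X} :
    MeasurableSpace (MPHomeo μ) :=
  borel (MPHomeo μ)

instance {X : Type u} [TopologicalSpace X] [MeasurableSpace X] {μ : Measure X} :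
    BorelSpace (MPHomeo μ) :=
  ⟨rfl⟩

end MPHomeo

/-- A set is `F_σ` if it is a countable union of closed sets. -/
def IsFSigma {X : Type u} [TopologicalSpace X] (S : Set X) : Prop :=
  ∃ K : ℕ → Set X, (∀ n, IsClosed (K n)) ∧ S = ⋃ n, K n

open Set Filter Topology TopologicalSpace Function
open scoped ENNReal symmDiff

/-! Up to a null set, `B` is an increasing union of compact sets `K k`, and `y ∈ f '' K k` is a
closed condition on `(f, y)`. Each `f` satisfies it for almost every `y` with some `k`; by Fubini,
almost every `y` satisfies it for almost every `f`. Both claims then follow from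
`exists_perfect_forall_mem_ae`, with the roles of `f` and `y` exchanged: on a suitable perfect set
of one variable, almost every value of the other admits a single `k`. Fixing `k` makes the good
values a closed set, whence the `F_σ` sets.

That lemma rests on separability of `L¹`: in an uncountable family some members are approximated by
others both in the topology and in measure. A branching sequence with errors `2⁻ⁿ` and
Borel–Cantelli then yield the perfect set. -/

/-- The intersection is the diagonal of the product of the open sets, closed in a Polish space. -/
theorem IsGδ.polishSpace {X : Type*} [TopologicalSpace X] [PolishSpace X] {s : Set X}
    (hs : IsGδ s) : PolishSpace s := by
  obtain ⟨U, hU, rfl⟩ := hs.eq_iInter_nat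
  have : ∀ n, PolishSpace (U n) := fun n => (hU n).polishSpace
  let j : (⋂ n, U n : Set X) → ∀ n, U n := fun x n => ⟨x.1, mem_iInter.1 x.2 n⟩
  have hj : Continuous j := by fun_prop
  have hp : Continuous fun z : ∀ n, U n => (z 0).1 := by fun_prop
  have he : IsEmbedding j := IsEmbedding.of_comp hj hp IsEmbedding.subtypeVal
  have hr : range j = {z | ∀ n, (z n).1 = (z 0).1} := by
    ext z
    constructor
    · rintro ⟨x, rfl⟩ n
      rfl
    · intro hz
      exact ⟨⟨(z 0).1, mem_iInter.2 fun n => hz n ▸ (z n).2⟩,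
        funext fun n => Subtype.ext (hz n).symm⟩
  have hc : IsClosed (range j) := by
    rw [hr, ofPred_forall]
    exact isClosed_iInter fun n => isClosed_eq (by fun_prop) (by fun_prop)
  exact IsClosedEmbedding.polishSpace ⟨he, hc⟩

theorem MeasureTheory.exists_monotone_isCompact_measure_diff_eq_zero {X : Type*}
    [TopologicalSpace X] [PolishSpace X] [MeasurableSpace X] [BorelSpace X]
    (ρ : Measure X) [IsFiniteMeasure ρ] {s : Set X} (hs : MeasurableSet s) :
    ∃ K : ℕ → Set X, Monotone K ∧ (∀ n, IsCompact (K n)) ∧ (∀ n, K n ⊆ s) ∧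
      ρ (s \ ⋃ n, K n) = 0 := by
  have h : ∀ n : ℕ, ∃ K ⊆ s, IsCompact K ∧ ρ (s \ K) < ((n : ℝ≥0∞) + 1)⁻¹ := fun n =>
    hs.exists_isCompact_sdiff_lt (measure_ne_top ρ s) (by simp)
  choose K hKs hKc hKρ using h
  refine ⟨accumulate K, monotone_accumulate, fun n => ?_, fun n => ?_, ?_⟩
  · exact (finite_Iic n).isCompact_biUnion fun i _ => hKc i
  · exact iUnion₂_subset fun i _ => hKs i
  · rw [iUnion_accumulate]
    have h0 : Tendsto (fun n : ℕ => ((n : ℝ≥0∞) + 1)⁻¹) atTop (𝓝 0) := by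
      simpa using (tendsto_add_atTop_iff_nat 1).2 ENNReal.tendsto_inv_nat_nhds_zero
    exact nonpos_iff_eq_zero.1 (ge_of_tendsto' h0 fun n =>
      (measure_mono (sdiff_subset_sdiff_right (subset_iUnion K n))).trans (hKρ n).le)

/-! ### Perfect sets with a uniform index -/

/-- The sequence in which every term but the first is obtained by `next` from an earlier term, and
every term is used infinitely often. -/
def branchingSeq {α : Type*} (a : α) (next : α → ℕ → α) : ℕ → α
  | 0 => a
  | n + 1 => next (branchingSeq a next n.unpair.1) n
decreasing_by exact Nat.lt_succ_of_le (Nat.unpair_left_le n)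

theorem branchingSeq_succ {α : Type*} (a : α) (next : α → ℕ → α) (n : ℕ) :
    branchingSeq a next (n + 1) = next (branchingSeq a next n.unpair.1) n := by
  rw [branchingSeq]

/-- Among uncountably many increasing sequences of measurable sets there are, near each of some
nonempty family of them, others that are almost the same, uniformly in the index. -/
theorem exists_condensation {X Y : Type*} [MeasurableSpace X]
    [MeasurableSpace.CountablyGenerated X] (m : Measure X) [IsFiniteMeasure m]
    [TopologicalSpace Y] [SecondCountableTopology Y]
    {E : ℕ → Y → Set X} (hE : ∀ y, Monotone fun k => E k y)
    (hEm : ∀ k y, MeasurableSet (E k y)) {S : Set Y} (hS : ¬ S.Countable) :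
    ∃ D ⊆ S, D.Nonempty ∧ ∀ y ∈ D, ∀ U ∈ 𝓝 y, ∀ ε : ℝ≥0∞, 0 < ε →
      ∃ y' ∈ D, y' ∈ U ∧ y' ≠ y ∧ m (⋃ k, E k y \ E k y') < ε := by
  let ρ : Measure (X × ℕ) := m.prod Measure.count
  -- Recording only the increments of `E k y` keeps the total mass at most `m univ`, so the
  -- indicator is in `L¹`.
  let T : Y → Set (X × ℕ) := fun y => {p | p.1 ∈ disjointed (fun k => E k y) p.2}
  have hd : ∀ y k, MeasurableSet (disjointed (fun k => E k y) k) := fun y k =>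
    MeasurableSet.disjointed (fun k => hEm k y) k
  have hTm : ∀ y, MeasurableSet (T y) := fun y => by
    have : T y = ⋃ k, disjointed (fun k => E k y) k ×ˢ {k} := by
      ext ⟨x, k⟩
      simp [T]
    rw [this]
    exact MeasurableSet.iUnion fun k => (hd y k).prod (measurableSet_singleton k)
  have hρ : ∀ A : Set (X × ℕ), MeasurableSet A → ρ A = ∑' k, m {x | (x, k) ∈ A} := fun A hA => by
    rw [Measure.prod_apply_symm hA, lintegral_count]
    rfl
  have hTfin : ∀ y, ρ (T y) ≠ ∞ := fun y => by
    rw [hρ _ (hTm y)]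
    change ∑' k, m (disjointed (fun k => E k y) k) ≠ ∞
    rw [← measure_iUnion (disjoint_disjointed _) (hd y)]
    exact measure_ne_top _ _
  let Φ : S → Y × Lp ℝ 1 ρ := fun y => (y.1, indicatorConstLp 1 (hTm y.1) (hTfin y.1) 1)
  -- This topology also records `L¹` distance, yet stays second countable, so a perfect set for it
  -- has the required approximations.
  let τ : TopologicalSpace S := TopologicalSpace.induced Φ inferInstance
  have : @SecondCountableTopology S τ := by
    have : Fact ((1 : ℝ≥0∞) ≠ ∞) := ⟨by simp⟩
    exact secondCountableTopology_induced _ _ Φ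
  have hΦ : @Continuous S _ τ _ Φ := continuous_induced_dom
  obtain ⟨D, hD, hDne, -⟩ := exists_perfect_nonempty_of_isClosed_of_not_countable
    (α := S) isClosed_univ (by rwa [countable_univ_iff])
  refine ⟨Subtype.val '' D, by rintro _ ⟨y, -, rfl⟩; exact y.2, hDne.image _, ?_⟩
  rintro _ ⟨y, hy, rfl⟩ U hU ε hε
  have hV : Φ ⁻¹' (U ×ˢ Metric.eball (Φ y).2 ε) ∈ @nhds S τ y :=
    hΦ.continuousAt.preimage_mem_nhds (prod_mem_nhds hU (Metric.eball_mem_nhds _ hε))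
  obtain ⟨y', ⟨⟨hy'U, hy'ε⟩, hy'D⟩, hne⟩ := preperfect_iff_nhds.1 hD.acc y hy _ hV
  refine ⟨y', ⟨y', hy'D, rfl⟩, hy'U, fun h => hne (Subtype.ext h), ?_⟩
  rw [Metric.mem_eball, edist_comm, edist_indicatorConstLp_eq_enorm] at hy'ε
  refine lt_of_le_of_lt ?_ hy'ε
  have hen : ‖indicatorConstLp (μ := ρ) 1 ((hTm y).symmDiff (hTm y'))
      (measure_symmDiff_ne_top (hTfin y) (hTfin y')) (1 : ℝ)‖ₑ = ρ (T y ∆ T y') := by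
    rw [indicatorConstLp, Lp.enorm_toLp, eLpNorm_indicator_const
      ((hTm y).symmDiff (hTm y')) (by simp) (by simp)]
    simp
  rw [hen, hρ _ ((hTm y).symmDiff (hTm y'))]
  refine (measure_mono ?_).trans (measure_iUnion_le _)
  -- If `x` enters the first sequence at stage `j ≤ k`, it cannot enter the second at `j`, since it
  -- is still absent at `k`.
  refine iUnion_subset fun k x hx => ?_
  have hx1 : x ∈ ⋃ j ∈ Finset.Iic k, disjointed (fun k => E k (y : Y)) j := by
    rw [biUnion_Iic_disjointed, (hE y).partialSups_eq]
    exact hx.1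
  obtain ⟨j, hj, hxj⟩ := mem_iUnion₂.1 hx1
  refine mem_iUnion.2 ⟨j, Or.inl ⟨hxj, fun h => hx.2 ?_⟩⟩
  exact hE y' (Finset.mem_Iic.1 hj) (disjointed_subset (fun k => E k (y' : Y)) j h)

/-- If for uncountably many `y` almost every `x` belongs to the union over `k` of the sets `E k y`,
then there is a perfect set of `y` for which, for almost every `x`, this holds with
a single `k`. -/
theorem exists_perfect_forall_mem_ae {X Y : Type*} [MeasurableSpace X]
    [MeasurableSpace.CountablyGenerated X] (m : Measure X) [IsFiniteMeasure m]
    [TopologicalSpace Y] [PolishSpace Y]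
    {E : ℕ → Y → Set X} (hE : ∀ y, Monotone fun k => E k y)
    (hEm : ∀ k y, MeasurableSet (E k y)) (hEc : ∀ k x, IsClosed {y | x ∈ E k y})
    {S : Set Y} (hS : ¬ S.Countable) (hSE : ∀ y ∈ S, ∀ᵐ x ∂m, ∃ k, x ∈ E k y) :
    ∃ P : Set Y, Perfect P ∧ P.Nonempty ∧ ∀ᵐ x ∂m, ∃ k, ∀ y ∈ P, x ∈ E k y := by
  let := TopologicalSpace.upgradeIsCompletelyMetrizable Y
  obtain ⟨D, hDS, ⟨y₀, hy₀⟩, hD⟩ := exists_condensation m hE hEm hS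
  have hnext : ∀ (y : D) (n : ℕ), ∃ y' : D, (y' : Y) ∈ Metric.ball (y : Y) ((1 / 2) ^ n) ∧
      (y' : Y) ≠ y ∧ m (⋃ k, E k y \ E k y') < (2 : ℝ≥0∞)⁻¹ ^ n := fun y n => by
    obtain ⟨y', h1, h2, h3, h4⟩ := hD y y.2 _ (Metric.ball_mem_nhds _ (by positivity : (0 : ℝ) < (1 / 2) ^ n)) _
      (ENNReal.pow_pos (by simp : (0 : ℝ≥0∞) < 2⁻¹) n)
    exact ⟨⟨y', h1⟩, h2, h3, h4⟩
  choose next hball hne hm using hnext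
  let y : ℕ → Y := fun n => (branchingSeq ⟨y₀, hy₀⟩ next n : D)
  have hyD : ∀ n, y n ∈ D := fun n => (branchingSeq (α := D) ⟨y₀, hy₀⟩ next n).2
  have hyb : ∀ n, y (n + 1) ∈ Metric.ball (y n.unpair.1) ((1 / 2) ^ n) := fun n => by
    simp only [y, branchingSeq_succ]
    exact hball _ n
  have hyne : ∀ n, y (n + 1) ≠ y n.unpair.1 := fun n => by
    simp only [y, branchingSeq_succ]
    exact hne _ n
  have hym : ∀ n, m (⋃ k, E k (y n.unpair.1) \ E k (y (n + 1))) ≤ (2 : ℝ≥0∞)⁻¹ ^ n := fun n => by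
    simp only [y, branchingSeq_succ]
    exact (hm _ n).le
  have hacc : Preperfect (range y) := by
    rw [preperfect_iff_nhds]
    rintro _ ⟨j, rfl⟩ U hU
    obtain ⟨ε, hε, hεU⟩ := Metric.mem_nhds_iff.1 hU
    obtain ⟨N, hN⟩ := exists_pow_lt_of_lt_one hε (by norm_num : (1 / 2 : ℝ) < 1)
    -- Stage `Nat.pair j N` branches off `y j`, at radius at most `(1 / 2) ^ N`.
    have hn : N ≤ Nat.pair j N := Nat.right_le_pair j N
    have h1 := hyb (Nat.pair j N)
    have h2 := hyne (Nat.pair j N)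
    rw [Nat.unpair_pair] at h1 h2
    refine ⟨_, ⟨hεU ?_, mem_range_self _⟩, h2⟩
    exact Metric.ball_subset_ball
      ((pow_le_pow_of_le_one (by norm_num) (by norm_num) hn).trans hN.le) h1
  refine ⟨closure (range y), hacc.perfect_closure, (range_nonempty y).closure, ?_⟩
  have hsum : ∑' n, m (⋃ k, E k (y n.unpair.1) \ E k (y (n + 1))) ≠ ∞ := by
    refine ne_top_of_le_ne_top ?_ (ENNReal.tsum_le_tsum hym)
    rw [ENNReal.tsum_geometric]
    simp
  filter_upwards [ae_eventually_notMem hsum, ae_all_iff.2 fun n => hSE _ (hDS (hyD n))]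
    with x hx1 hx2
  obtain ⟨N, hN⟩ := eventually_atTop.1 hx1
  choose κ hκ using hx2
  -- This `k` serves the terms up to `N`; each later term inherits it from its parent.
  obtain ⟨k, hk⟩ := ((finite_Iic N).image κ).bddAbove
  have hall : ∀ n, x ∈ E k (y n) := fun n => by
    induction n using Nat.strong_induction_on with
    | _ n ih =>
      rcases le_or_gt n N with hn | hn
      · exact hE _ (hk ⟨n, hn, rfl⟩) (hκ n)
      · obtain ⟨n, rfl⟩ : ∃ l, n = l + 1 := ⟨n - 1, by omega⟩
        by_contra h
        exact hN n (by omega) (mem_iUnion.2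
          ⟨k, ih _ (Nat.lt_succ_of_le (Nat.unpair_left_le n)), h⟩)
  exact ⟨k, fun z hz => closure_minimal (range_subset_iff.2 hall) (hEc k x) hz⟩

/-! ### The Polish space of measure-preserving homeomorphisms -/

theorem ContinuousMap.isOpen_setOf_forall_mem_ne {X Y : Type*} [TopologicalSpace X]
    [CompactSpace X] [TopologicalSpace Y] [T2Space Y] {D : Set (X × X)} (hD : IsClosed D) :
    IsOpen {f : C(X, Y) | ∀ p ∈ D, f p.1 ≠ f p.2} := by
  have h : IsClosed {q : C(X, Y) × (X × X) | q.2 ∈ D ∧ q.1 q.2.1 = q.1 q.2.2} :=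
    (hD.preimage continuous_snd).inter (isClosed_eq (by fun_prop) (by fun_prop))
  convert (isClosedMap_fst_of_compactSpace _ h).isOpen_compl using 1
  ext f
  simp

theorem ContinuousMap.isGδ_setOf_injective {X Y : Type*} [TopologicalSpace X]
    [CompactSpace X] [MetrizableSpace X] [TopologicalSpace Y] [T2Space Y] :
    IsGδ {f : C(X, Y) | Injective f} := by
  let := metrizableSpaceMetric X
  have : {f : C(X, Y) | Injective f} =
      ⋂ n : ℕ, {f : C(X, Y) | ∀ p ∈ {p : X × X | 1 / ((n : ℝ) + 1) ≤ dist p.1 p.2},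
        f p.1 ≠ f p.2} := by
    ext f
    simp only [mem_ofPred_eq, mem_iInter]
    constructor
    · intro hf n p hp h
      have h0 : (0 : ℝ) < 1 / ((n : ℝ) + 1) := by positivity
      rw [hf h, dist_self] at hp
      linarith
    · intro hf x y hxy
      by_contra hne
      obtain ⟨n, hn⟩ := exists_nat_one_div_lt (dist_pos.2 hne)
      exact hf n (x, y) hn.le hxy
  rw [this]
  exact IsGδ.iInter_of_isOpen fun n =>
    isOpen_setOf_forall_mem_ne (isClosed_le continuous_const continuous_dist)

/-- Bounded continuous test functions determine a finite measure, and their integrals vary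
continuously with `f` by dominated convergence. -/
theorem ContinuousMap.isClosed_setOf_measurePreserving {X : Type*} [TopologicalSpace X]
    [CompactSpace X] [PolishSpace X] [MeasurableSpace X] [BorelSpace X]
    (μ : Measure X) [IsFiniteMeasure μ] :
    IsClosed {f : C(X, X) | MeasurePreserving f μ μ} := by
  have : {f : C(X, X) | MeasurePreserving f μ μ} =
      ⋂ g : BoundedContinuousFunction X ℝ,
        {f : C(X, X) | ∫ x, g (f x) ∂μ = ∫ x, g x ∂μ} := by
    ext f
    have hf : Measurable f := f.continuous.measurable
    have hi : ∀ g : BoundedContinuousFunction X ℝ, ∫ x, g x ∂(μ.map f) = ∫ x, g (f x) ∂μ :=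
      fun g => integral_map hf.aemeasurable g.continuous.aestronglyMeasurable
    simp only [mem_ofPred_eq, mem_iInter, ← hi]
    refine ⟨fun h g => by rw [h.map_eq], fun h => ⟨hf, ?_⟩⟩
    exact ext_of_forall_integral_eq_of_IsFiniteMeasure h
  rw [this]
  refine isClosed_iInter fun g => isClosed_eq ?_ continuous_const
  refine continuous_of_dominated (bound := fun _ => ‖g‖) (fun f => ?_) (fun f => ?_)
    (integrable_const _) ?_
  · exact (g.continuous.comp f.continuous).aestronglyMeasurable
  · exact ae_of_all _ fun x => g.norm_coe_le_norm _
  · exact ae_of_all _ fun x => by fun_prop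

namespace MPHomeo

variable {X : Type*} [TopologicalSpace X] [MeasurableSpace X] {μ : Measure X}

theorem isEmbedding_toContinuousMap : IsEmbedding (toContinuousMap : MPHomeo μ → C(X, X)) :=
  ⟨⟨rfl⟩, fun _ _ h => Subtype.ext (Homeomorph.ext fun x => DFunLike.congr_fun h x)⟩

theorem continuous_toContinuousMap : Continuous (toContinuousMap : MPHomeo μ → C(X, X)) :=
  isEmbedding_toContinuousMap.continuous

theorem measurePreserving (f : MPHomeo μ) : MeasurePreserving f.toHomeo μ μ := f.2

/-- Surjectivity is automatic: the complement of the compact image is open and null, hence empty. -/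
theorem range_toContinuousMap [CompactSpace X] [T2Space X] [BorelSpace X] [IsFiniteMeasure μ]
    [μ.IsOpenPosMeasure] : range (toContinuousMap : MPHomeo μ → C(X, X)) =
      {f : C(X, X) | MeasurePreserving f μ μ} ∩ {f : C(X, X) | Injective f} := by
  ext f
  constructor
  · rintro ⟨f, rfl⟩
    exact ⟨f.2, f.toHomeo.injective⟩
  · rintro ⟨hf, hi⟩
    have hs : Surjective f := by
      have hc : IsClosed (range f) := (isCompact_range f.continuous).isClosed
      have h0 : μ (range f)ᶜ = 0 := by
        rw [← hf.measure_preimage hc.isOpen_compl.measurableSet.nullMeasurableSet]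
        simp
      rw [hc.isOpen_compl.measure_eq_zero_iff μ, compl_empty_iff] at h0
      exact range_eq_univ.1 h0
    refine ⟨⟨Continuous.homeoOfEquivCompactToT2 (f := Equiv.ofBijective f ⟨hi, hs⟩)
      f.continuous, hf⟩, ?_⟩
    rfl

theorem polishSpace [CompactSpace X] [PolishSpace X] [BorelSpace X] [IsFiniteMeasure μ]
    [μ.IsOpenPosMeasure] : PolishSpace (MPHomeo μ) := by
  have : PolishSpace C(X, X) := by
    let := upgradeIsCompletelyMetrizable X
    infer_instance
  have hG : IsGδ (range (toContinuousMap : MPHomeo μ → C(X, X))) := by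
    rw [range_toContinuousMap (μ := μ)]
    exact (ContinuousMap.isClosed_setOf_measurePreserving μ).isGδ.inter
      ContinuousMap.isGδ_setOf_injective
  have := hG.polishSpace
  exact (isEmbedding_toContinuousMap.toHomeomorph).isClosedEmbedding.polishSpace

theorem isClosed_setOf_mem_image [CompactSpace X] [T2Space X] {K : Set X} (hK : IsClosed K) :
    IsClosed {p : MPHomeo μ × X | p.2 ∈ p.1.toHomeo '' K} := by
  have h1 : Continuous fun q : (MPHomeo μ × X) × X => q.1.1.toContinuousMap q.2 :=
    continuous_eval.comp
      ((continuous_toContinuousMap.comp (continuous_fst.comp continuous_fst)).prodMk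
        continuous_snd)
  have h : IsClosed {q : (MPHomeo μ × X) × X | q.2 ∈ K ∧ q.1.1.toContinuousMap q.2 = q.1.2} :=
    (hK.preimage continuous_snd).inter (isClosed_eq h1 (by fun_prop))
  convert isClosedMap_fst_of_compactSpace _ h using 1
  ext p
  exact ⟨fun ⟨x, hx, h⟩ => ⟨(p, x), ⟨hx, h⟩, rfl⟩,
    fun ⟨q, ⟨hx, h⟩, e⟩ => ⟨q.2, hx, by subst e; exact h⟩⟩

theorem measure_compl_image_eq_zero [CompactSpace X] [T2Space X] [BorelSpace X] (f : MPHomeo μ)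
    {A : Set X} (hA : MeasurableSet A) (h : μ Aᶜ = 0) : μ (f.toHomeo '' A)ᶜ = 0 := by
  have hm : MeasurableSet (f.toHomeo '' A) :=
    (f.toHomeo.toMeasurableEquiv.measurableSet_image).2 hA
  rw [← f.measurePreserving.measure_preimage hm.compl.nullMeasurableSet, preimage_compl,
    preimage_image_eq _ f.toHomeo.injective, h]

end MPHomeo

/-! ### The two claims -/

theorem preperfect_univ_nat_bool : Preperfect (univ : Set (ℕ → Bool)) := by
  rw [preperfect_iff_nhds]
  intro a _ U hU
  have ht : Tendsto (fun n => update a n (!a n)) atTop (𝓝 a) := by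
    refine tendsto_pi_nhds.2 fun i => tendsto_const_nhds.congr' ?_
    filter_upwards [eventually_gt_atTop i] with n hn
    rw [update_of_ne hn.ne]
  obtain ⟨n, hn⟩ := (ht.eventually hU).exists
  refine ⟨_, ⟨hn, mem_univ _⟩, fun h => ?_⟩
  simpa using congrFun h n

theorem IsFSigma.inter {X : Type*} [TopologicalSpace X] {S T : Set X} (hS : IsFSigma S)
    (hT : IsFSigma T) : IsFSigma (S ∩ T) := by
  obtain ⟨K, hK, rfl⟩ := hS
  obtain ⟨L, hL, rfl⟩ := hT
  refine ⟨fun n => K n.unpair.1 ∩ L n.unpair.2, fun n => (hK _).inter (hL _), ?_⟩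
  rw [iUnion_inter_iUnion, iUnion_unpair fun i j => K i ∩ L j]

theorem mainTheorem12 {H : Type u} [AddCommGroup H] [TopologicalSpace H] [IsTopologicalAddGroup H]
    [CompactSpace H] [PolishSpace H] [MeasurableSpace H] [BorelSpace H]
    (μ : Measure H) [μ.IsAddHaarMeasure]
    (G : Set (MPHomeo μ)) (hG : IsGδ G) (hGunc : ¬ G.Countable)
    (B : Set H) (hB : μ Bᶜ = 0) :
    (∀ (ν : Measure G) [SigmaFinite ν],
      ∃ (P : Set H) (W : Set (MPHomeo μ)),
        Perfect P ∧ P.Nonempty ∧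
        IsFSigma W ∧ W ⊆ G ∧ ν {g : G | (g : MPHomeo μ) ∉ W} = 0 ∧
        ∀ f ∈ W, P ⊆ f.toHomeo '' B) ∧
    (∃ (Q : Set (MPHomeo μ)) (W : Set H),
        Perfect Q ∧ Q.Nonempty ∧ Q ⊆ G ∧
        IsFSigma W ∧ μ Wᶜ = 0 ∧
        ∀ f ∈ Q, W ⊆ f.toHomeo '' B) := by
  have : PolishSpace (MPHomeo μ) := MPHomeo.polishSpace
  have : PolishSpace G := hG.polishSpace
  obtain ⟨K, hKmono, hKc, hKB, hK0⟩ : ∃ K : ℕ → Set H, Monotone K ∧ (∀ n, IsClosed (K n)) ∧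
      (∀ n, K n ⊆ B) ∧ μ (⋃ n, K n)ᶜ = 0 := by
    obtain ⟨K, h1, h2, h3, h4⟩ := exists_monotone_isCompact_measure_diff_eq_zero μ
      (measurableSet_toMeasurable μ Bᶜ).compl
    refine ⟨K, h1, fun n => (h2 n).isClosed, fun n => (h3 n).trans
      (compl_subset_comm.1 (subset_toMeasurable μ Bᶜ)), ?_⟩
    refine measure_mono_null (t := toMeasurable μ Bᶜ ∪ _) (fun x hx => ?_)
      (measure_union_null ((measure_toMeasurable _).trans hB) h4)
    by_cases hxB : x ∈ toMeasurable μ Bᶜ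
    · exact Or.inl hxB
    · exact Or.inr ⟨hxB, hx⟩
  have hKm : MeasurableSet (⋃ n, K n) := .iUnion fun n => (hKc n).measurableSet
  have hEc : ∀ k, IsClosed {p : G × H | p.2 ∈ p.1.1.toHomeo '' K k} := fun k =>
    (MPHomeo.isClosed_setOf_mem_image (hKc k)).preimage
      (by fun_prop : Continuous fun p : G × H => ((p.1 : MPHomeo μ), p.2))
  have hEmono : ∀ (g : G) (x : H), Monotone fun k => x ∈ g.1.toHomeo '' K k :=
    fun g x i j hij => fun h => image_mono (hKmono hij) h
  have hae : ∀ g : G, ∀ᵐ x ∂μ, ∃ k, x ∈ g.1.toHomeo '' K k := fun g => by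
    have := g.1.measure_compl_image_eq_zero hKm hK0
    rw [image_iUnion] at this
    filter_upwards [compl_mem_ae_iff.2 this] with x hx
    simpa using hx
  constructor
  · intro ν _
    -- Non-discreteness makes `μ` atomless, so a co-null set of `y` is uncountable.
    have : NeBot (𝓝[≠] (0 : H)) := by
      by_contra hbot
      rw [not_neBot] at hbot
      have hd : DiscreteTopology H := discreteTopology_of_isOpen_singleton_zero
        (isOpen_singleton_iff_punctured_nhds _ |>.2 hbot)
      have : Finite H := finite_of_compact_of_discrete
      have : Finite (MPHomeo μ) := Finite.of_injective (fun f => (f.toHomeo : H → H))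
        fun f g h => Subtype.ext (Homeomorph.ext fun x => congrFun h x)
      exact hGunc G.to_countable
    -- Intersecting with these compact sets puts `W` inside `G` while keeping it `F_σ` in the whole
    -- space.
    obtain ⟨L, hLmono, hLc, -, hL0⟩ := exists_monotone_isCompact_measure_diff_eq_zero
      ν.toFinite MeasurableSet.univ
    have hS : ∀ᵐ y ∂μ, ∀ᵐ g ∂ν.toFinite, ∃ k, y ∈ g.1.toHomeo '' K k := by
      refine (Measure.ae_ae_comm (p := fun (g : G) (y : H) => ∃ k, y ∈ g.1.toHomeo '' K k) ?_).1
        (ae_of_all _ hae)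
      rw [ofPred_exists]
      exact .iUnion fun k => (hEc k).measurableSet
    obtain ⟨P, hP, hPne, hPae⟩ := exists_perfect_forall_mem_ae ν.toFinite
      (E := fun k y => {g : G | y ∈ g.1.toHomeo '' K k})
      (S := {y | ∀ᵐ g ∂ν.toFinite, ∃ k, y ∈ g.1.toHomeo '' K k})
      (fun y i j hij g => hEmono g y hij)
      (fun k y => ((hEc k).preimage (by fun_prop : Continuous fun g : G => (g, y))).measurableSet)
      (fun k g => (hEc k).preimage (by fun_prop : Continuous fun y : H => (g, y)))
      (fun hc => by
        have h1 := hc.ae_notMem μ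
        have h2 : ∀ᵐ _ ∂μ, False := by
          filter_upwards [h1, hS] with y h1 h2 using h1 h2
        simp [NeZero.ne μ] at h2)
      (fun y hy => by simpa only [mem_ofPred_eq] using hy)
    refine ⟨P, (⋃ k, {f | ∀ y ∈ P, y ∈ f.toHomeo '' K k}) ∩ ⋃ n, Subtype.val '' L n, hP, hPne,
      IsFSigma.inter ⟨_, fun k => ?_, rfl⟩ ⟨_, fun n => ?_, rfl⟩, ?_, ?_, ?_⟩
    · simp only [ofPred_forall]
      exact isClosed_biInter fun y _ => (MPHomeo.isClosed_setOf_mem_image (hKc k)).preimage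
        (by fun_prop : Continuous fun f : MPHomeo μ => (f, y))
    · exact ((hLc n).image continuous_subtype_val).isClosed
    · rintro f ⟨-, hf⟩
      obtain ⟨n, g, -, rfl⟩ := mem_iUnion.1 hf
      exact g.2
    · refine absolutelyContinuous_toFinite ν ?_
      have hL : ∀ᵐ g ∂ν.toFinite, g ∈ ⋃ n, L n := by
        rw [ae_iff]
        rwa [← compl_eq_univ_sdiff] at hL0
      change ∀ᵐ g : G ∂ν.toFinite, _
      filter_upwards [hL, hPae] with g h1 h2
      refine ⟨mem_iUnion.2 h2, ?_⟩
      obtain ⟨n, hn⟩ := mem_iUnion.1 h1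
      exact mem_iUnion.2 ⟨n, g, hn, rfl⟩
    · rintro f ⟨hf, -⟩ y hy
      obtain ⟨k, hk⟩ := mem_iUnion.1 hf
      exact image_mono (hKB k) (hk y hy)
  · obtain ⟨P, hP, hPne, hPae⟩ := exists_perfect_forall_mem_ae μ
      (E := fun k (g : G) => g.1.toHomeo '' K k) (S := univ)
      (fun g i j hij x => hEmono g x hij)
      (fun k g => ((hEc k).preimage (by fun_prop : Continuous fun y : H => (g, y))).measurableSet)
      (fun k y => (hEc k).preimage (by fun_prop : Continuous fun g : G => (g, y)))
      (by rwa [countable_univ_iff])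
      (fun g _ => hae g)
    -- `P` is closed only relative to `G`; a Cantor set inside it is compact, hence closed in the
    -- whole space.
    obtain ⟨φ, hφP, hφc, hφi⟩ : ∃ φ : (ℕ → Bool) → G, range φ ⊆ P ∧ Continuous φ ∧ Injective φ := by
      let := upgradeIsCompletelyMetrizable G
      exact hP.exists_nat_bool_injection hPne
    let ψ : (ℕ → Bool) → MPHomeo μ := fun a => φ a
    have hψc : Continuous ψ := continuous_subtype_val.comp hφc
    have hψi : Injective ψ := Subtype.val_injective.comp hφi
    refine ⟨range ψ, ⋃ k, {y | ∀ g ∈ P, y ∈ g.1.toHomeo '' K k},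
      ⟨(isCompact_range hψc).isClosed, ?_⟩, range_nonempty ψ, ?_, ⟨_, fun k => ?_, rfl⟩, ?_, ?_⟩
    · rw [preperfect_iff_nhds]
      rintro _ ⟨a, rfl⟩ U hU
      obtain ⟨b, ⟨hbU, -⟩, hb⟩ := preperfect_iff_nhds.1 preperfect_univ_nat_bool a
        (mem_univ a) _ (hψc.continuousAt.preimage_mem_nhds hU)
      exact ⟨ψ b, ⟨hbU, mem_range_self b⟩, hψi.ne hb⟩
    · rintro _ ⟨a, rfl⟩
      exact (φ a).2
    · simp only [ofPred_forall]
      exact isClosed_biInter fun g _ => (hEc k).preimage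
        (by fun_prop : Continuous fun y : H => (g, y))
    · rw [← mem_ae_iff]
      filter_upwards [hPae] with y hy
      exact mem_iUnion.2 hy
    · rintro _ ⟨a, rfl⟩ y hy
      obtain ⟨k, hk⟩ := mem_iUnion.1 hy
      exact image_mono (hKB k) (hk (φ a) (hφP (mem_range_self a)))
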